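/- Real $2\times 2$ matrices carry the operator norm $\|\cdot\|_2$ induced by the Euclidean norm of $\mathbb R^2$. An ordered measure is a countably additive $\mathrm M_2(\mathbb R)$-valued Borel measure $\phi$ on a real interval, of finite total variation $\int\|\phi\|_2$ (taken with respect to $\|\cdot\|_2$) and without point masses; its left time-ordered exponential is \[\operatorname{Lexp}\phi=\mathrm{Id}_2+\sum_{n\ge1}\int_{t_1\le\cdots\le t_n}\phi(t_n)\cdots\phi(t_1).\] The real Magnus exponent of $A\in \mathrm M_2(\mathbb R)$ is \[\mathcal M(A)=\inf\Big\{\int\|\phi\|_2 : \phi \text{ an ordered measure with } \operatorname{Lexp}\phi=A\Big\}\in[0,+\infty]\] (with $\inf\emptyset=+\infty$). The chiral disk of $A=\begin{bmatrix}a&b\\c&d\end{bmatrix}$ is the closed disk $\mathrm{CD}(A)\subset\mathbb C$ with center $\frac{a+d}2+\frac{c-b}2\,\mathrm i$ and radius $\sqrt{\left(\frac{a-d}2\right)^2+\left(\frac{b+c}2\right)^2}$. **Theorem.** Let $A\in\mathrm M_2(\mathbb R)$ satisfy $\mathrm{CD}(A)\subset\exp\{w\in\mathbb C:|w|<\pi\}$.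 Then the set \[\{\lambda\in[0,\pi) : \mathrm{CD}(A)\subset\exp\{w\in\mathbb C:|w|\le\lambda\}\}\] has a least element, and $\mathcal M(A)$ is equal to it. Equivalently, \[\mathcal M(A)=\sup\{|\log z| : z\in\mathrm{CD}(A)\},\] where $\log$ is the principal branch of the complex logarithm. In particular, $\mathcal M(A)<\pi$. -/

import Mathlib

open scoped Matrix.Norms.L2Operator ENNReal

noncomputable section

/-- An ordered measure with values in a Banach algebra `𝔄`: a countably additive `𝔄`-valued Borel
measure of finite total variation, without point masses, on an interval of the real line. It is
extended by zero to all of `ℝ`, so every interval is allowed. -/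
structure OrderedMeasure (𝔄 : Type*) [NormedRing 𝔄] where
  /-- the underlying vector measure -/
  toVectorMeasure : MeasureTheory.VectorMeasure ℝ 𝔄
  finite_variation : toVectorMeasure.variation Set.univ < ∞
  continuous : ∀ t : ℝ, toVectorMeasure {t} = 0

namespace OrderedMeasure

/-- The cumulative norm `∫ |φ|`, i.e. the total variation of `φ` with respect to the norm of `𝔄`. -/
def cumulativeNorm {𝔄 : Type*} [NormedRing 𝔄] (φ : OrderedMeasure 𝔄) : ℝ≥0∞ :=
  φ.toVectorMeasure.variation Set.univ

/-- The iterated integral `∫_{t₁ ≤ t₂ ≤ ⋯ ≤ tₙ, tₙ ∈ S} φ(tₙ) ⋯ φ(t₂) φ(t₁)`, defined by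
integrating the last variable outermost: `∫_{s ∈ S} dφ(s) * (iterated integral over (-∞, s])`.
The pairing `(ContinuousLinearMap.mul ℝ 𝔄).flip` sends `(x, y)` to `y * x`, where `x` is the
value of the integrand and `y` the value of the measure. -/
def iteratedIntegral {𝔄 : Type*} [NormedRing 𝔄] [NormedAlgebra ℝ 𝔄] (φ : OrderedMeasure 𝔄) :
    ℕ → Set ℝ → 𝔄
  | 0, _ => 1
  | n + 1, S =>
    (φ.toVectorMeasure.restrict S).integral (fun s => iteratedIntegral φ n (Set.Iic s))
      (ContinuousLinearMap.mul ℝ 𝔄).flip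

/-- The left time-ordered exponential
`Lexp φ = ∑ₙ ∫_{t₁ ≤ ⋯ ≤ tₙ} φ(tₙ) ⋯ φ(t₁)` (later times stand on the left). -/
def Lexp {𝔄 : Type*} [NormedRing 𝔄] [NormedAlgebra ℝ 𝔄] (φ : OrderedMeasure 𝔄) : 𝔄 :=
  ∑' n : ℕ, φ.iteratedIntegral n Set.univ

end OrderedMeasure

/-- The Magnus exponent of an element `A` of a real Banach algebra: the infimum of the cumulative
norms of the ordered measures `φ` with `Lexp φ = A`; it is `∞` if there is no such `φ`. -/
def magnusExponent {𝔄 : Type*} [NormedRing 𝔄] [NormedAlgebra ℝ 𝔄] [CompleteSpace 𝔄] (A : 𝔄) :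
    ℝ≥0∞ :=
  ⨅ (φ : OrderedMeasure 𝔄) (_ : φ.Lexp = A), φ.cumulativeNorm

/-- The chiral disk of the real matrix `!![a, b; c, d]`: the closed disk with center
`(a + d) / 2 + i (c - b) / 2` and radius `√(((a - d) / 2) ^ 2 + ((b + c) / 2) ^ 2)`. -/
def chiralDisk (A : Matrix (Fin 2) (Fin 2) ℝ) : Set ℂ :=
  Metric.closedBall (⟨(A 0 0 + A 1 1) / 2, (A 1 0 - A 0 1) / 2⟩ : ℂ)
    (Real.sqrt (((A 0 0 - A 1 1) / 2) ^ 2 + ((A 0 1 + A 1 0) / 2) ^ 2))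

end

open MeasureTheory Set Filter Topology

/-! Identify `ℝ²` with `ℂ`, so that `A` acts as `z ↦ p z + q z̄`. The ratios `A x / x = p + q x̄ /
x` trace the boundary circle of the chiral disk. Compactness gives a point `z₀ = exp (m u)` of the
disk, `|u| = 1`, at which `|log|` attains its maximum `m < π`.

Lower bound. Along the evolution a vector `y` satisfies `|dy / y| ≤ ‖φ‖`, so `A x / x` has a
logarithm of modulus at most `∫‖φ‖`. If this integral is below `π`, that logarithm is the principal
one (`norm_log_complexAction_div_le`). As `z₀` lies on the boundary circle, it is some `A x / x`.

Upper bound. At `z₀` the disk is tangent to the level curve of `|log|`, so for `m > 0` its center is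
`exp (m u) (1 - r u)` and its radius `r |exp (m u)|` (`center_of_isMax_norm_log`). Containment in
the sublevel set bounds `r` by `(1 - exp (-2 m Re u)) / (2 Re u)`, or by the limit value `m` when
`Re u = 0`. This is exactly the range of radii reached at time `m` by `ρ' = σ (1 - 2 (Re u) ρ)`, `ρ
0 = 0`, `σ ∈ [0, 1]`. Matrices with parts `exp (t u) (1 - ρ u)` and `κ u exp (t u) ρ` then solve `X'
= h X` with `‖h‖ ≤ 1`, and `h dt` on `[0, m]` is the required measure.

The passage between ordered exponentials and evolutions rests on the Volterra equation of `φ` and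
the uniqueness of its bounded solution. -/

/-! ### Cutting atomless measures -/

/-- A finite atomless measure on the line is cut by a chain of lower sets into pieces of equal
mass. -/
theorem exists_lowerSet_chain (ν : Measure ℝ) [IsFiniteMeasure ν] [NullSingletonClass ν] {N : ℕ}
    (hN : 0 < N) :
    ∃ S : ℕ → Set ℝ, S 0 = ∅ ∧ S N = univ ∧ (∀ k, IsLowerSet (S k)) ∧
      (∀ k, S k ⊆ S (k + 1)) ∧ ∀ k < N, ν.real (S (k + 1) \ S k) ≤ ν.real univ / N := by
  set T := ν.real univ with hT
  have hT0 : 0 ≤ T := measureReal_nonneg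
  have hN' : (0 : ℝ) < N := by exact_mod_cast hN
  rcases hT0.eq_or_lt with h0 | hpos
  · refine ⟨fun k => if k = 0 then ∅ else univ, by simp, by simp [hN.ne'], ?_, ?_, ?_⟩
    · intro k
      dsimp only
      split_ifs
      exacts [isLowerSet_empty, isLowerSet_univ]
    · intro k
      simp
    · intro k _
      calc ν.real _ ≤ T := measureReal_mono (subset_univ _)
        _ = T / N := by rw [← h0]; simp
  set F : ℝ → ℝ := fun t => ν.real (Iic t) with hF
  have hFmono : Monotone F := fun s t h => measureReal_mono (Iic_subset_Iic.2 h)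
  have hFcont : Continuous F := by
    have h1 : Continuous fun t => F 0 + ∫ x in (0 : ℝ)..t, (1 : ℝ) ∂ν :=
      continuous_const.add (intervalIntegral.continuous_primitive
        (fun a b => intervalIntegrable_const) 0)
    refine h1.congr fun t => ?_
    have key : ∀ a b : ℝ, a ≤ b → ν.real (Ioc a b) = F b - F a := fun a b hab => by
      rw [← Iic_sdiff_Iic, measureReal_sdiff (Iic_subset_Iic.2 hab) measurableSet_Iic]
    rcases le_total 0 t with h | h
    · rw [intervalIntegral.integral_of_le h]
      simp [key _ _ h]
    · rw [intervalIntegral.integral_of_ge h]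
      simp [key _ _ h]
  have htop : Tendsto F atTop (𝓝 T) := by
    have := tendsto_measure_Iic_atTop ν
    exact (ENNReal.tendsto_toReal (measure_ne_top _ _)).comp this
  have hbot : Tendsto F atBot (𝓝 0) := by
    have h := tendsto_measure_iInter_atBot (μ := ν) (s := fun t : ℝ => Iic t)
      (fun t => measurableSet_Iic.nullMeasurableSet) (fun s t h => Iic_subset_Iic.2 h)
      ⟨0, measure_ne_top _ _⟩
    rw [iInter_Iic_eq_empty_iff.2 (by simp [not_bddBelow_univ]), measure_empty] at h
    exact (ENNReal.tendsto_toReal ENNReal.zero_ne_top).comp h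
  -- The range conditions sit inside the existential so that `choose` yields a total quantile
  -- function; outside `(0, T)` its value is irrelevant.
  have hivt : ∀ c : ℝ, ∃ t, 0 < c → c < T → F t = c := by
    intro c
    by_cases hc : 0 < c ∧ c < T
    · obtain ⟨a, ha⟩ := (hbot.eventually (gt_mem_nhds hc.1)).exists
      obtain ⟨b, hb⟩ := (htop.eventually (lt_mem_nhds hc.2)).exists
      obtain ⟨t, ht⟩ := mem_range_of_exists_le_of_exists_ge hFcont ⟨a, ha.le⟩ ⟨b, hb.le⟩
      exact ⟨t, fun _ _ => ht⟩
    · exact ⟨0, fun h1 h2 => absurd ⟨h1, h2⟩ hc⟩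
  choose t ht using hivt
  set S : ℕ → Set ℝ := fun k => if k = 0 then ∅ else if N ≤ k then univ else Iic (t (k * T / N))
    with hS
  have hmeas : ∀ k, MeasurableSet (S k) := by
    intro k
    simp only [hS]
    split_ifs
    exacts [MeasurableSet.empty, MeasurableSet.univ, measurableSet_Iic]
  have hval : ∀ k ≤ N, ν.real (S k) = k * T / N := by
    intro k hk
    simp only [hS]
    split_ifs with h1 h2
    · simp [h1]
    · have : k = N := le_antisymm hk h2
      subst this
      field_simp
      rfl
    · refine ht _ ?_ ?_
      · have : (0 : ℝ) < k := by exact_mod_cast Nat.pos_of_ne_zero h1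
        positivity
      · rw [div_lt_iff₀ hN', mul_comm]
        exact mul_lt_mul_of_pos_left (by exact_mod_cast not_le.1 h2) hpos
  have hsub : ∀ k, S k ⊆ S (k + 1) := by
    intro k
    by_cases h1 : k = 0
    · simp [hS, h1]
    by_cases h2 : N ≤ k + 1
    · simp [hS, h2]
    have h3 : ¬ N ≤ k := by omega
    have e1 : S k = Iic (t (k * T / N)) := by simp [hS, h1, h3]
    have e2 : S (k + 1) = Iic (t ((k + 1 : ℕ) * T / N)) := by simp [hS, h2]
    rw [e1, e2]
    refine Iic_subset_Iic.2 (hFmono.reflect_lt ?_).le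
    have v1 := hval k (by omega)
    have v2 := hval (k + 1) (by omega)
    rw [e1] at v1
    rw [e2] at v2
    change F _ = _ at v1
    change F _ = _ at v2
    rw [v1, v2]
    gcongr
    simp
  refine ⟨S, by simp [hS], by simp [hS, hN.ne'], ?_, hsub, ?_⟩
  · intro k
    simp only [hS]
    split_ifs
    exacts [isLowerSet_empty, isLowerSet_univ, isLowerSet_Iic _]
  · intro k hk
    rw [measureReal_sdiff (hsub k) (hmeas k), hval _ hk, hval _ hk.le]
    push_cast
    apply le_of_eq
    field_simp
    ring

theorem IsLowerSet.measurableSet_real {S : Set ℝ} (h : IsLowerSet S) : MeasurableSet S :=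
  h.ordConnected.measurableSet

/-! ### Iterated integrals of ordered measures -/

namespace OrderedMeasure

variable {𝔄 : Type*} [NormedRing 𝔄] (φ : OrderedMeasure 𝔄)

/-- The total variation of an ordered measure. -/
noncomputable abbrev var : Measure ℝ := φ.toVectorMeasure.variation

instance isFiniteMeasure_var : IsFiniteMeasure φ.var := ⟨φ.finite_variation⟩

instance nullSingletonClass_var : NullSingletonClass φ.var where
  measure_singleton t := by
    rw [VectorMeasure.variation_apply_eq_zero (measurableSet_singleton t)]
    intro s hs _
    rcases subset_singleton_iff_eq.1 hs with rfl | rfl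
    · simp
    · exact φ.continuous t

theorem cumulativeNorm_eq : φ.cumulativeNorm = ENNReal.ofReal (φ.var.real univ) := by
  simp [cumulativeNorm, measureReal_def]

variable [NormedAlgebra ℝ 𝔄]

/-- The integral `∫_S dφ(s) f(s)`, with the values of the measure on the left. -/
noncomputable def leftIntegral (f : ℝ → 𝔄) (S : Set ℝ) : 𝔄 :=
  (φ.toVectorMeasure.restrict S).integral f (ContinuousLinearMap.mul ℝ 𝔄).flip

theorem iteratedIntegral_zero (S : Set ℝ) : φ.iteratedIntegral 0 S = 1 := by
  simp [iteratedIntegral]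

theorem iteratedIntegral_succ (n : ℕ) (S : Set ℝ) :
    φ.iteratedIntegral (n + 1) S =
      φ.leftIntegral (fun s => φ.iteratedIntegral n (Iic s)) S := by
  simp [iteratedIntegral, leftIntegral]

@[simp]
theorem leftIntegral_empty (f : ℝ → 𝔄) : φ.leftIntegral f ∅ = 0 := by
  simp [leftIntegral]

theorem norm_leftIntegral_le {f : ℝ → 𝔄} {S : Set ℝ} {C : ℝ} (h : ∀ x ∈ S, ‖f x‖ ≤ C) :
    ‖φ.leftIntegral f S‖ ≤ C * φ.var.real S := by
  rcases S.eq_empty_or_nonempty with rfl | ⟨x, hx⟩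
  · simp
  have hC : 0 ≤ C := (norm_nonneg _).trans (h x hx)
  have hB : ‖(ContinuousLinearMap.mul ℝ 𝔄).flip‖ ≤ 1 := by
    rw [ContinuousLinearMap.opNorm_flip]
    exact ContinuousLinearMap.opNorm_mul_le ℝ 𝔄
  calc ‖φ.leftIntegral f S‖ ≤ C * ‖(ContinuousLinearMap.mul ℝ 𝔄).flip‖ * φ.var.real S :=
        VectorMeasure.norm_setIntegral_le_of_norm_le_const h
    _ ≤ C * 1 * φ.var.real S := by gcongr
    _ = _ := by ring

theorem leftIntegral_sub_sets {f : ℝ → 𝔄} (hf : Integrable f φ.var) {S T : Set ℝ}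
    (hS : MeasurableSet S) (hT : MeasurableSet T) (hTS : T ⊆ S) :
    φ.leftIntegral f S - φ.leftIntegral f T = φ.leftIntegral f (S \ T) :=
  (VectorMeasure.setIntegral_sdiff hS hT (VectorMeasure.Integrable.integrableOn hf) hTS).symm

theorem leftIntegral_sub {f g : ℝ → 𝔄} (hf : Integrable f φ.var) (hg : Integrable g φ.var)
    (S : Set ℝ) :
    φ.leftIntegral (fun x => f x - g x) S = φ.leftIntegral f S - φ.leftIntegral g S :=
  VectorMeasure.integral_fun_sub (VectorMeasure.Integrable.restrict hf)
    (VectorMeasure.Integrable.restrict hg)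

theorem leftIntegral_sum {ι : Type*} (s : Finset ι) {f : ι → ℝ → 𝔄}
    (hf : ∀ i ∈ s, Integrable (f i) φ.var) (S : Set ℝ) :
    φ.leftIntegral (fun x => ∑ i ∈ s, f i x) S = ∑ i ∈ s, φ.leftIntegral (f i) S :=
  VectorMeasure.integral_finsetSum s fun i hi => VectorMeasure.Integrable.restrict (hf i hi)

theorem leftIntegral_mul_right [CompleteSpace 𝔄] {f : ℝ → 𝔄} (hf : Integrable f φ.var)
    (v : 𝔄) (S : Set ℝ) :
    φ.leftIntegral (fun x => f x * v) S = φ.leftIntegral f S * v := by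
  have hf' : Integrable f (φ.toVectorMeasure.restrict S).variation :=
    VectorMeasure.Integrable.restrict hf
  have h1 := VectorMeasure.integral_continuousLinearMap_comp
    (B := (ContinuousLinearMap.mul ℝ 𝔄).flip) (C := (ContinuousLinearMap.mul ℝ 𝔄).flip v) hf'
  have h2 := VectorMeasure.continuousLinearMap_apply_integral
    (B := (ContinuousLinearMap.mul ℝ 𝔄).flip) (C := (ContinuousLinearMap.mul ℝ 𝔄).flip v) hf'
  simp only [ContinuousLinearMap.flip_apply, ContinuousLinearMap.mul_apply'] at h1 h2
  rw [leftIntegral, leftIntegral, h1, h2]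
  congr 1
  ext x y
  simp [mul_assoc]

/-- Dominated convergence: as `t → t₀` the indicators of `Iic t` converge except at `t₀` itself,
which is null because there are no atoms. -/
theorem continuous_leftIntegral_Iic {f : ℝ → 𝔄} (hf : Integrable f φ.var) :
    Continuous fun t => φ.leftIntegral f (Iic t) := by
  have h : ∀ t, φ.leftIntegral f (Iic t) =
      φ.toVectorMeasure.integral ((Iic t).indicator f) (ContinuousLinearMap.mul ℝ 𝔄).flip :=
    fun t => (VectorMeasure.integral_indicator measurableSet_Iic).symm
  simp only [h]
  rw [continuous_iff_continuousAt]
  intro t₀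
  refine VectorMeasure.continuousAt_of_dominated (bound := fun x => ‖f x‖)
    (Eventually.of_forall fun t => hf.aestronglyMeasurable.indicator measurableSet_Iic)
    (Eventually.of_forall fun t => Eventually.of_forall fun x => norm_indicator_le_norm_self _ _)
    hf.norm ?_
  have hne : ∀ᵐ x ∂φ.var, x ≠ t₀ := by
    rw [ae_iff]
    simp
  filter_upwards [hne] with x hx
  rcases hx.lt_or_gt with hlt | hgt
  · refine (continuousAt_const (y := f x)).congr ?_
    filter_upwards [lt_mem_nhds hlt] with t ht
    simp [indicator, ht.le]
  · refine (continuousAt_const (y := (0 : 𝔄))).congr ?_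
    filter_upwards [gt_mem_nhds hgt] with t ht
    simp [indicator, not_le.2 ht]

/-- Continuity and boundedness go through one induction, since together they make each integrand
integrable for the next step. -/
theorem iteratedIntegral_regular (n : ℕ) :
    Continuous (fun t => φ.iteratedIntegral n (Iic t)) ∧
      ∃ C, ∀ S, ‖φ.iteratedIntegral n S‖ ≤ C := by
  induction n with
  | zero =>
    simp only [iteratedIntegral_zero]
    exact ⟨continuous_const, ‖(1 : 𝔄)‖, fun _ => le_rfl⟩
  | succ n ih =>
    obtain ⟨hc, C, hC⟩ := ih
    have hC0 : 0 ≤ C := (norm_nonneg _).trans (hC ∅)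
    have hi : Integrable (fun t => φ.iteratedIntegral n (Iic t)) φ.var :=
      Integrable.of_bound hc.aestronglyMeasurable C (Eventually.of_forall fun t => hC _)
    simp only [iteratedIntegral_succ]
    refine ⟨φ.continuous_leftIntegral_Iic hi, C * φ.var.real univ, fun S => ?_⟩
    refine (φ.norm_leftIntegral_le fun x _ => hC _).trans ?_
    gcongr
    · simp
    · exact subset_univ _

theorem integrable_iteratedIntegral (n : ℕ) :
    Integrable (fun t => φ.iteratedIntegral n (Iic t)) φ.var := by
  obtain ⟨hc, C, hC⟩ := φ.iteratedIntegral_regular n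
  exact Integrable.of_bound hc.aestronglyMeasurable C (Eventually.of_forall fun t => hC _)

end OrderedMeasure

/-! ### Geometric decay and the Volterra equation -/

/-- Iterating a Volterra-type estimate over an atomless measure gives geometric decay. -/
theorem exists_geometric_bound {E : Type*} [NormedAddCommGroup E] (ν : Measure ℝ)
    [IsFiniteMeasure ν] [NullSingletonClass ν] (J : ℕ → Set ℝ → E) {b : ℝ}
    (h0 : ∀ S, IsLowerSet S → ‖J 0 S‖ ≤ b) (hempty : ∀ n, J (n + 1) ∅ = 0)
    (hstep : ∀ n S T, IsLowerSet S → IsLowerSet T → T ⊆ S → ∀ C,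
      (∀ u ∈ S \ T, ‖J n (Iic u)‖ ≤ C) → ‖J (n + 1) S - J (n + 1) T‖ ≤ C * ν.real (S \ T)) :
    ∃ K, 0 ≤ K ∧ ∀ n S, IsLowerSet S → ‖J n S‖ ≤ K * (1 / 2) ^ n := by
  have hb : 0 ≤ b := (norm_nonneg _).trans (h0 ∅ isLowerSet_empty)
  obtain ⟨N, hN⟩ := exists_nat_gt (4 * ν.real univ)
  have hN0 : (0 : ℝ) < N := lt_of_le_of_lt (by positivity) hN
  obtain ⟨S, hS0, hSN, hlow, -, hmass⟩ := exists_lowerSet_chain ν (N := N) (by exact_mod_cast hN0)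
  have hq : ν.real univ / N ≤ 1 / 4 := by
    rw [div_le_iff₀ hN0]
    linarith
  -- Each piece has mass at most `1/4` and costs a factor `2`: the new piece and the old part each
  -- contribute half of `b * 2 ^ (k + 1) * (1 / 2) ^ (n + 1)`.
  have main : ∀ k ≤ N, ∀ n T, IsLowerSet T → T ⊆ S k → ‖J n T‖ ≤ b * 2 ^ k * (1 / 2) ^ n := by
    intro k
    induction k with
    | zero =>
      intro _ n T hT hTS
      rw [hS0, subset_empty_iff] at hTS
      subst hTS
      cases n with
      | zero => simpa using h0 _ hT
      | succ n =>
        rw [hempty, norm_zero]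
        positivity
    | succ k ih =>
      intro hk n
      induction n with
      | zero =>
        intro T hT _
        refine (h0 T hT).trans ?_
        rw [pow_zero, mul_one]
        exact le_mul_of_one_le_right hb (one_le_pow₀ (by norm_num))
      | succ n ihn =>
        intro T hT hTS
        have hR : IsLowerSet (T ∩ S k) := hT.inter (hlow k)
        have h1 := ih (by omega) (n + 1) _ hR inter_subset_right
        have h2 := hstep n T (T ∩ S k) hT hR inter_subset_left (b * 2 ^ (k + 1) * (1 / 2) ^ n)
          (fun u hu => ihn _ (isLowerSet_Iic u)
            fun x hx => hlow _ hx (hTS hu.1))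
        have h3 : ν.real (T \ (T ∩ S k)) ≤ 1 / 4 := by
          refine le_trans (measureReal_mono ?_) ((hmass k (by omega)).trans hq)
          intro x hx
          exact ⟨hTS hx.1, fun h => hx.2 ⟨hx.1, h⟩⟩
        have h4 : ‖J (n + 1) T‖ ≤ ‖J (n + 1) T - J (n + 1) (T ∩ S k)‖ + ‖J (n + 1) (T ∩ S k)‖ := by
          simpa using norm_add_le (J (n + 1) T - J (n + 1) (T ∩ S k)) (J (n + 1) (T ∩ S k))
        have h5 : b * 2 ^ (k + 1) * (1 / 2) ^ n * ν.real (T \ (T ∩ S k)) ≤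
            b * 2 ^ (k + 1) * (1 / 2) ^ n * (1 / 4) := by gcongr
        calc ‖J (n + 1) T‖ ≤ b * 2 ^ (k + 1) * (1 / 2) ^ n * (1 / 4) +
              b * 2 ^ k * (1 / 2) ^ (n + 1) := by linarith
          _ = b * 2 ^ (k + 1) * (1 / 2) ^ (n + 1) := by ring
  refine ⟨b * 2 ^ N, by positivity, fun n T hT => main N le_rfl n T hT ?_⟩
  rw [hSN]
  exact subset_univ _

namespace OrderedMeasure

variable {𝔄 : Type*} [NormedRing 𝔄] [NormedAlgebra ℝ 𝔄] (φ : OrderedMeasure 𝔄)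

/-- The time-ordered exponential of `φ` restricted to the set `S`, for lower sets `S`. -/
noncomputable def evolution (S : Set ℝ) : 𝔄 := ∑' n : ℕ, φ.iteratedIntegral n S

theorem evolution_univ : φ.evolution univ = φ.Lexp := rfl

theorem exists_norm_iteratedIntegral_le :
    ∃ K, 0 ≤ K ∧ ∀ n S, IsLowerSet S → ‖φ.iteratedIntegral n S‖ ≤ K * (1 / 2) ^ n := by
  refine exists_geometric_bound φ.var φ.iteratedIntegral (b := ‖(1 : 𝔄)‖) ?_ ?_ ?_
  · intro S _
    rw [iteratedIntegral_zero]
  · intro n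
    rw [iteratedIntegral_succ, leftIntegral_empty]
  · intro n S T hS hT hTS C hC
    rw [iteratedIntegral_succ, iteratedIntegral_succ,
      φ.leftIntegral_sub_sets (φ.integrable_iteratedIntegral n) hS.measurableSet_real
        hT.measurableSet_real hTS]
    exact φ.norm_leftIntegral_le hC

theorem exists_norm_evolution_le : ∃ K, ∀ S, IsLowerSet S → ‖φ.evolution S‖ ≤ K := by
  obtain ⟨K, _, h⟩ := φ.exists_norm_iteratedIntegral_le
  exact ⟨K * 2, fun S hS => tsum_of_norm_bounded (hasSum_geometric_two.mul_left K)
    fun n => h n S hS⟩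

variable [CompleteSpace 𝔄]

theorem hasSum_evolution {S : Set ℝ} (hS : IsLowerSet S) :
    HasSum (fun n => φ.iteratedIntegral n S) (φ.evolution S) := by
  obtain ⟨K, _, h⟩ := φ.exists_norm_iteratedIntegral_le
  exact (Summable.of_norm_bounded
    ((summable_geometric_of_lt_one (by norm_num) (by norm_num)).mul_left K)
    fun n => h n S hS).hasSum

theorem integrable_evolution : Integrable (fun t => φ.evolution (Iic t)) φ.var := by
  obtain ⟨K, hK⟩ := φ.exists_norm_evolution_le
  refine Integrable.of_bound ?_ K (Eventually.of_forall fun t => hK _ (isLowerSet_Iic t))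
  refine aestronglyMeasurable_of_tendsto_ae atTop
    (f := fun n t => ∑ m ∈ Finset.range n, φ.iteratedIntegral m (Iic t)) (fun n => ?_)
    (Eventually.of_forall fun t => (φ.hasSum_evolution (isLowerSet_Iic t)).tendsto_sum_nat)
  exact (continuous_finsetSum _ fun m _ => (φ.iteratedIntegral_regular m).1).aestronglyMeasurable

/-- The evolution solves the Volterra equation of `φ`. -/
theorem evolution_eq {S : Set ℝ} (hS : IsLowerSet S) :
    φ.evolution S = 1 + φ.leftIntegral (fun t => φ.evolution (Iic t)) S := by
  obtain ⟨K, hK0, hK⟩ := φ.exists_norm_iteratedIntegral_le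
  have hint : ∀ n : ℕ, ∀ m ∈ Finset.range n,
      Integrable (fun t => φ.iteratedIntegral m (Iic t)) φ.var :=
    fun n m _ => φ.integrable_iteratedIntegral m
  have h1 : Tendsto (fun n => ∑ m ∈ Finset.range (n + 1), φ.iteratedIntegral m S) atTop
      (𝓝 (φ.evolution S)) :=
    (φ.hasSum_evolution hS).tendsto_sum_nat.comp (tendsto_add_atTop_nat 1)
  have h2 : ∀ n, ∑ m ∈ Finset.range (n + 1), φ.iteratedIntegral m S =
      1 + φ.leftIntegral (fun t => ∑ m ∈ Finset.range n, φ.iteratedIntegral m (Iic t)) S := by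
    intro n
    rw [Finset.sum_range_succ', iteratedIntegral_zero, add_comm, φ.leftIntegral_sum _ (hint n)]
    simp only [iteratedIntegral_succ]
  have h3 : Tendsto (fun n =>
      φ.leftIntegral (fun t => ∑ m ∈ Finset.range n, φ.iteratedIntegral m (Iic t)) S) atTop
      (𝓝 (φ.leftIntegral (fun t => φ.evolution (Iic t)) S)) := by
    refine VectorMeasure.tendsto_integral_filter_of_norm_le_const ?_ ⟨K * 2, ?_⟩ ?_
    · exact Eventually.of_forall fun n =>
        (continuous_finsetSum _ fun m _ => (φ.iteratedIntegral_regular m).1).aestronglyMeasurable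
    · refine Eventually.of_forall fun n => Eventually.of_forall fun t => ?_
      refine (norm_sum_le_of_le _ fun m _ => hK m _ (isLowerSet_Iic t)).trans ?_
      rw [← Finset.mul_sum]
      gcongr
      have h := (summable_geometric_two).sum_le_tsum (Finset.range n) fun i _ => by positivity
      rwa [tsum_geometric_two] at h
    · exact Eventually.of_forall fun t => (φ.hasSum_evolution (isLowerSet_Iic t)).tendsto_sum_nat
  refine tendsto_nhds_unique h1 ?_
  simp only [h2]
  exact tendsto_const_nhds.add h3

theorem evolution_sub {S T : Set ℝ} (hS : IsLowerSet S) (hT : IsLowerSet T) (hTS : T ⊆ S) :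
    φ.evolution S - φ.evolution T = φ.leftIntegral (fun t => φ.evolution (Iic t)) (S \ T) := by
  rw [φ.evolution_eq hS, φ.evolution_eq hT, add_sub_add_left_eq_sub,
    φ.leftIntegral_sub_sets φ.integrable_evolution hS.measurableSet_real hT.measurableSet_real hTS]

@[simp]
theorem evolution_empty : φ.evolution ∅ = 1 := by
  rw [φ.evolution_eq isLowerSet_empty, leftIntegral_empty, add_zero]

/-- The Volterra equation of `φ` has at most one bounded solution. -/
theorem Lexp_eq_of_solution {x : ℝ → 𝔄} (hx : Integrable x φ.var)
    (hbound : ∃ C, ∀ t, ‖x t‖ ≤ C) (hsol : ∀ t, x t = 1 + φ.leftIntegral x (Iic t)) :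
    φ.Lexp = 1 + φ.leftIntegral x univ := by
  obtain ⟨C, hC⟩ := hbound
  have hC0 : 0 ≤ C := (norm_nonneg _).trans (hC 0)
  obtain ⟨K, hK⟩ := φ.exists_norm_evolution_le
  set D : Set ℝ → 𝔄 := fun S =>
    φ.leftIntegral (fun t => x t - φ.evolution (Iic t)) S with hD
  have hint : Integrable (fun t => x t - φ.evolution (Iic t)) φ.var :=
    hx.sub φ.integrable_evolution
  have hDt : ∀ t, D (Iic t) = x t - φ.evolution (Iic t) := by
    intro t
    simp only [hD]
    rw [φ.leftIntegral_sub hx φ.integrable_evolution]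
    conv_rhs => rw [hsol t, φ.evolution_eq (isLowerSet_Iic t)]
    abel
  -- The difference of two solutions is a fixed point of the Volterra operator. As a constant
  -- sequence it obeys the geometric bound for every `n`, hence vanishes.
  obtain ⟨R, _, hR⟩ := exists_geometric_bound φ.var (fun _ => D) (b := (C + K) * φ.var.real univ)
    (fun S _ => by
      refine (φ.norm_leftIntegral_le (C := C + K) fun t _ =>
        (norm_sub_le _ _).trans (add_le_add (hC t) (hK _ (isLowerSet_Iic t)))).trans ?_
      have : 0 ≤ K := (norm_nonneg _).trans (hK ∅ isLowerSet_empty)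
      gcongr
      · simp
      · exact subset_univ S)
    (fun _ => by simp [hD])
    (fun _ S T hS hT hTS B hB => by
      simp only [hDt] at hB
      simp only [hD]
      rw [φ.leftIntegral_sub_sets hint hS.measurableSet_real hT.measurableSet_real hTS]
      exact φ.norm_leftIntegral_le hB)
  have hlim : Tendsto (fun n : ℕ => R * (1 / 2 : ℝ) ^ n) atTop (𝓝 0) := by
    simpa using (tendsto_pow_atTop_nhds_zero_of_lt_one (r := (1 / 2 : ℝ)) (by norm_num)
      (by norm_num)).const_mul R
  have hzero : D univ = 0 := by
    rw [← norm_le_zero_iff]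
    exact ge_of_tendsto' hlim fun n => hR n univ isLowerSet_univ
  rw [← evolution_univ, φ.evolution_eq isLowerSet_univ]
  simp only [hD] at hzero
  rw [φ.leftIntegral_sub hx φ.integrable_evolution, sub_eq_zero] at hzero
  rw [hzero]

/-- Relative increment of a solution over a set of small variation. -/
theorem norm_evolution_mul_sub_le {S T : Set ℝ} (hS : IsLowerSet S) (hT : IsLowerSet T)
    (hTS : T ⊆ S) {ε : ℝ} (hε : φ.var.real (S \ T) ≤ ε) (hε1 : ε < 1) (v : 𝔄) :
    ‖φ.evolution S * v - φ.evolution T * v‖ ≤ ε / (1 - ε) * ‖φ.evolution T * v‖ := by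
  obtain ⟨K, hK⟩ := φ.exists_norm_evolution_le
  have hε0 : 0 ≤ ε := measureReal_nonneg.trans hε
  -- Gronwall by a supremum: the largest norm `M` between `T` and `S` satisfies `M ≤ ‖φ.evolution T
  -- * v‖ + M ε`, and the increment is at most `M ε`.
  set Q : Set ℝ := {r | ∃ R, IsLowerSet R ∧ T ⊆ R ∧ R ⊆ S ∧ r = ‖φ.evolution R * v‖}
  have hQne : Q.Nonempty := ⟨_, T, hT, Subset.rfl, hTS, rfl⟩
  have hQbdd : BddAbove Q := by
    refine ⟨K * ‖v‖, ?_⟩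
    rintro r ⟨R, hR, -, -, rfl⟩
    exact (norm_mul_le _ _).trans (by gcongr; exact hK R hR)
  have hM0 : 0 ≤ sSup Q := (norm_nonneg _).trans (le_csSup hQbdd ⟨T, hT, Subset.rfl, hTS, rfl⟩)
  have hstep : ∀ R, IsLowerSet R → T ⊆ R → R ⊆ S →
      ‖φ.evolution R * v - φ.evolution T * v‖ ≤ sSup Q * ε := by
    intro R hR hTR hRS
    rw [← sub_mul, φ.evolution_sub hR hT hTR,
      ← φ.leftIntegral_mul_right φ.integrable_evolution]
    refine (φ.norm_leftIntegral_le (C := sSup Q) fun u hu => le_csSup hQbdd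
      ⟨Iic u, isLowerSet_Iic u, ?_, fun x hx => hRS (hR hx hu.1), rfl⟩).trans ?_
    · intro x hx
      by_contra h
      exact hu.2 (hT (not_le.1 h).le hx)
    · gcongr
      exact (measureReal_mono (sdiff_subset_sdiff_left hRS)).trans hε
  have hM : sSup Q ≤ ‖φ.evolution T * v‖ + sSup Q * ε := by
    refine csSup_le hQne ?_
    rintro r ⟨R, hR, h1, h2, rfl⟩
    have := norm_le_norm_add_norm_sub' (φ.evolution R * v) (φ.evolution T * v)
    linarith [hstep R hR h1 h2]
  refine (hstep S hS hTS Subset.rfl).trans ?_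
  rw [div_mul_eq_mul_div, le_div_iff₀ (by linarith)]
  nlinarith

end OrderedMeasure

/-! ### Differential equations as ordered exponentials -/

/-- The integral against a vector measure with bounded density. -/
theorem vectorMeasure_integral_withDensityᵥ {X E F G : Type*} [MeasurableSpace X]
    [NormedAddCommGroup E] [NormedSpace ℝ E] [NormedAddCommGroup F] [NormedSpace ℝ F]
    [CompleteSpace F] [NormedAddCommGroup G] [NormedSpace ℝ G] [CompleteSpace G]
    (B : E →L[ℝ] F →L[ℝ] G) (μ : Measure X) [IsFiniteMeasure μ] {h : X → F} {f : X → E}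
    (hh : Integrable h μ) (hf : StronglyMeasurable f) {C : ℝ} (hC : ∀ x, ‖f x‖ ≤ C) :
    (μ.withDensityᵥ h).integral f B = ∫ x, B (f x) (h x) ∂μ := by
  have hfin : IsFiniteMeasure (μ.withDensityᵥ h).variation := by
    rw [Measure.variation_withDensityᵥ hh]
    exact ⟨by simpa [hasFiniteIntegral_iff_enorm] using hh.2⟩
  have hBint : ∀ g : X → E, StronglyMeasurable g → (∃ D, ∀ x, ‖g x‖ ≤ D) →
      Integrable (fun x => B (g x) (h x)) μ := by
    rintro g hg ⟨D, hD⟩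
    refine (hh.norm.const_mul (‖B‖ * D)).mono'
      (B.aestronglyMeasurable_comp₂ hg.aestronglyMeasurable hh.aestronglyMeasurable)
      (Eventually.of_forall fun x => ?_)
    refine (B.le_opNorm₂ _ _).trans ?_
    gcongr
    exact hD x
  have simple : ∀ g : SimpleFunc X E,
      (μ.withDensityᵥ h).integral g B = ∫ x, B (g x) (h x) ∂μ := by
    intro g
    induction g using SimpleFunc.induction with
    | const c hs =>
      rename_i s
      have e1 : ⇑(SimpleFunc.piecewise s hs (SimpleFunc.const X c) (SimpleFunc.const X 0)) =
          s.indicator fun _ => c := by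
        ext x
        simp [SimpleFunc.coe_piecewise, Set.piecewise, indicator]
      rw [e1, VectorMeasure.integral_indicator_const c hs, withDensityᵥ_apply hh hs,
        ← (B c).integral_comp_comm hh.integrableOn, ← integral_indicator hs]
      congr 1
      ext x
      by_cases hx : x ∈ s <;> simp [hx]
    | add hdisj h1 h2 =>
      rename_i g₁ g₂
      have i1 : ∀ g : SimpleFunc X E, Integrable (fun x => g x) (μ.withDensityᵥ h).variation :=
        fun g => SimpleFunc.integrable_of_isFiniteMeasure g
      have i2 : ∀ g : SimpleFunc X E, Integrable (fun x => B (g x) (h x)) μ := fun g =>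
        hBint g g.stronglyMeasurable g.exists_forall_norm_le
      have e1 : ∀ x, B ((g₁ + g₂) x) (h x) = B (g₁ x) (h x) + B (g₂ x) (h x) := fun x => by
        simp
      simp only [e1]
      rw [integral_add (i2 g₁) (i2 g₂), ← h1, ← h2]
      exact VectorMeasure.integral_fun_add (i1 g₁) (i1 g₂)
  have hC0 : ∀ x, 0 ≤ C := fun x => (norm_nonneg _).trans (hC x)
  have happ : ∀ x, Tendsto (fun n => hf.approxBounded C n x) atTop (𝓝 (f x)) := fun x =>
    hf.tendsto_approxBounded_of_norm_le (hC x)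
  have hbd : ∀ n x, ‖hf.approxBounded C n x‖ ≤ C := fun n x =>
    hf.norm_approxBounded_le (hC0 x) n x
  have t1 : Tendsto (fun n => (μ.withDensityᵥ h).integral (hf.approxBounded C n) B) atTop
      (𝓝 ((μ.withDensityᵥ h).integral f B)) :=
    VectorMeasure.tendsto_integral_filter_of_norm_le_const
      (Eventually.of_forall fun n => (hf.approxBounded C n).aestronglyMeasurable)
      ⟨C, Eventually.of_forall fun n => Eventually.of_forall fun x => hbd n x⟩
      (Eventually.of_forall happ)
  have t2 : Tendsto (fun n => ∫ x, B (hf.approxBounded C n x) (h x) ∂μ) atTop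
      (𝓝 (∫ x, B (f x) (h x) ∂μ)) := by
    refine tendsto_integral_of_dominated_convergence (fun x => ‖B‖ * C * ‖h x‖)
      (fun n => (hBint _ (hf.approxBounded C n).stronglyMeasurable
        ⟨C, hbd n⟩).aestronglyMeasurable) (hh.norm.const_mul _) (fun n => ?_) ?_
    · refine Eventually.of_forall fun x => (B.le_opNorm₂ _ _).trans ?_
      gcongr
      exact hbd n x
    · refine Eventually.of_forall fun x => ?_
      exact ((B.flip (h x)).continuous.tendsto _).comp (happ x)
  refine tendsto_nhds_unique t1 ?_
  simp only [simple]
  exact t2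

theorem vectorMeasure_restrict_withDensityᵥ {X E : Type*} [MeasurableSpace X]
    [NormedAddCommGroup E] [NormedSpace ℝ E] {μ : Measure X} {h : X → E} (hh : Integrable h μ)
    {S : Set X} (hS : MeasurableSet S) :
    (μ.withDensityᵥ h).restrict S = (μ.restrict S).withDensityᵥ h := by
  ext T hT
  rw [VectorMeasure.restrict_apply _ hS hT, withDensityᵥ_apply hh (hT.inter hS),
    withDensityᵥ_apply hh.restrict hT, Measure.restrict_restrict hT]

/-- A matrix-valued linear differential equation is solved by an ordered exponential. -/
theorem exists_orderedMeasure_of_hasDerivAt {𝔄 : Type*} [NormedRing 𝔄] [NormedAlgebra ℝ 𝔄]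
    [CompleteSpace 𝔄] {l : ℝ} (hl : 0 ≤ l) {h X : ℝ → 𝔄} (hcont : Continuous h)
    (hnorm : ∀ t, ‖h t‖ ≤ 1) (hX : ∀ t, HasDerivAt X (h t * X t) t) (hX0 : X 0 = 1) :
    ∃ φ : OrderedMeasure 𝔄, φ.Lexp = X l ∧ φ.cumulativeNorm ≤ ENNReal.ofReal l := by
  set μ : Measure ℝ := volume.restrict (Icc 0 l) with hμ
  have hh : Integrable h μ :=
    Integrable.of_bound hcont.aestronglyMeasurable 1 (Eventually.of_forall hnorm)
  have hvar : (μ.withDensityᵥ h).variation univ ≤ ENNReal.ofReal l := by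
    rw [Measure.variation_withDensityᵥ hh, withDensity_apply _ MeasurableSet.univ,
      Measure.restrict_univ]
    calc ∫⁻ x, ‖h x‖ₑ ∂μ ≤ ∫⁻ _, 1 ∂μ := lintegral_mono fun x => by
          rw [← ofReal_norm, ← ENNReal.ofReal_one]
          exact ENNReal.ofReal_le_ofReal (hnorm x)
      _ = ENNReal.ofReal l := by simp [hμ]
  let φ : OrderedMeasure 𝔄 :=
    { toVectorMeasure := μ.withDensityᵥ h
      finite_variation := hvar.trans_lt ENNReal.ofReal_lt_top
      continuous := fun t => by
        rw [withDensityᵥ_apply hh (measurableSet_singleton t)]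
        simp [hμ] }
  refine ⟨φ, ?_, hvar⟩
  have hXc : Continuous X := continuous_iff_continuousAt.2 fun t => (hX t).continuousAt
  -- Freezing `X` outside `[0, l]`, where the measure vanishes, gives a bounded solution of the
  -- Volterra equation on all of `ℝ`.
  set x : ℝ → 𝔄 := fun t => X (max 0 (min t l)) with hx
  have hxc : Continuous x := by fun_prop
  obtain ⟨C, hC⟩ : ∃ C, ∀ t, ‖x t‖ ≤ C := by
    obtain ⟨C, hC⟩ := (isCompact_Icc (a := 0) (b := l)).exists_bound_of_continuousOn
      hXc.continuousOn
    exact ⟨C, fun t => hC _ ⟨le_max_left _ _, max_le hl (min_le_right _ _)⟩⟩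
  have hleft : ∀ S, MeasurableSet S → φ.leftIntegral x S = ∫ s in S, h s * x s ∂μ := by
    intro S hS
    change ((μ.withDensityᵥ h).restrict S).integral x _ = _
    rw [vectorMeasure_restrict_withDensityᵥ hh hS, vectorMeasure_integral_withDensityᵥ _ _
      hh.restrict hxc.stronglyMeasurable hC]
    simp
  have hFTC : ∀ t, 0 ≤ t → t ≤ l → ∫ s in Icc 0 t, h s * x s = X t - 1 := by
    intro t h0 hl
    rw [integral_Icc_eq_integral_Ioc, ← intervalIntegral.integral_of_le h0, ← hX0,
      ← intervalIntegral.integral_eq_sub_of_hasDerivAt (f := X) (fun s _ => hX s)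
        ((hcont.mul hXc).intervalIntegrable _ _)]
    refine intervalIntegral.integral_congr fun s hs => ?_
    rw [uIcc_of_le h0] at hs
    simp [hx, hs.1, hs.2.trans hl]
  have hsol : ∀ t, x t = 1 + φ.leftIntegral x (Iic t) := by
    intro t
    rw [hleft _ measurableSet_Iic, hμ, Measure.restrict_restrict measurableSet_Iic]
    rcases lt_or_ge t 0 with h0 | h0
    · have e : Iic t ∩ Icc 0 l = ∅ := by
        ext s
        simp only [mem_inter_iff, mem_Iic, mem_Icc, mem_empty_iff_false, iff_false]
        intro hs
        linarith [hs.1, hs.2.1]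
      have e2 : max 0 (min t l) = 0 := max_eq_left ((min_le_left _ _).trans h0.le)
      simp [e, hx, e2, hX0]
    · have e : Iic t ∩ Icc 0 l = Icc 0 (min t l) := by
        ext s
        simp only [mem_inter_iff, mem_Iic, mem_Icc, le_min_iff]
        tauto
      rw [e, hFTC _ (le_min h0 hl) (min_le_right _ _)]
      simp [hx, max_eq_right (le_min h0 hl)]
  have hxi : Integrable x φ.var :=
    haveI := φ.isFiniteMeasure_var
    Integrable.of_bound hxc.aestronglyMeasurable C (Eventually.of_forall hC)
  rw [φ.Lexp_eq_of_solution hxi ⟨C, hC⟩ hsol, hleft _ MeasurableSet.univ, Measure.restrict_univ,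
    hμ, hFTC l hl le_rfl]
  abel

/-! ### Real `2 × 2` matrices acting on `ℂ` -/

/-- The complex linear part of a real `2 × 2` matrix acting on `ℂ = ℝ²`. -/
noncomputable def linPart (A : Matrix (Fin 2) (Fin 2) ℝ) : ℂ :=
  ⟨(A 0 0 + A 1 1) / 2, (A 1 0 - A 0 1) / 2⟩

/-- The conjugate linear part of a real `2 × 2` matrix acting on `ℂ = ℝ²`. -/
noncomputable def conjPart (A : Matrix (Fin 2) (Fin 2) ℝ) : ℂ :=
  ⟨(A 0 0 - A 1 1) / 2, (A 0 1 + A 1 0) / 2⟩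

/-- The matrix of the real linear map `z ↦ p * z + q * conj z`. -/
def ofParts (p q : ℂ) : Matrix (Fin 2) (Fin 2) ℝ :=
  !![p.re + q.re, q.im - p.im; p.im + q.im, p.re - q.re]

/-- The action of a real `2 × 2` matrix on `ℂ = ℝ²`. -/
noncomputable def complexAction (A : Matrix (Fin 2) (Fin 2) ℝ) (z : ℂ) : ℂ :=
  linPart A * z + conjPart A * (starRingEnd ℂ) z

/-- The matrix with first column `z` and second column zero. -/
def columnMatrix (z : ℂ) : Matrix (Fin 2) (Fin 2) ℝ := !![z.re, 0; z.im, 0]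

theorem ofParts_linPart_conjPart (A : Matrix (Fin 2) (Fin 2) ℝ) :
    ofParts (linPart A) (conjPart A) = A := by
  ext i j
  fin_cases i <;> fin_cases j <;> simp [ofParts, linPart, conjPart] <;> ring

theorem ofParts_mul (p q r s : ℂ) :
    ofParts p q * ofParts r s =
      ofParts (p * r + q * (starRingEnd ℂ) s) (p * s + q * (starRingEnd ℂ) r) := by
  ext i j
  fin_cases i <;> fin_cases j <;> simp [ofParts, Matrix.mul_apply] <;> ring

theorem ofParts_one_zero : ofParts 1 0 = 1 := by
  ext i j
  fin_cases i <;> fin_cases j <;> simp [ofParts]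

/-- Vectors are embedded in the algebra as columns, so that the estimates for `φ.evolution S * v`
control the motion of a vector. -/
theorem mul_columnMatrix (A : Matrix (Fin 2) (Fin 2) ℝ) (z : ℂ) :
    A * columnMatrix z = columnMatrix (complexAction A z) := by
  ext i j
  fin_cases i <;> fin_cases j <;>
    simp [columnMatrix, complexAction, linPart, conjPart, Matrix.mul_apply] <;> ring

theorem columnMatrix_sub (z w : ℂ) :
    columnMatrix z - columnMatrix w = columnMatrix (z - w) := by
  ext i j
  fin_cases i <;> fin_cases j <;> simp [columnMatrix]

theorem norm_columnMatrix (z : ℂ) : ‖columnMatrix z‖ = ‖z‖ := by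
  have h1 : (columnMatrix z).conjTranspose * columnMatrix z =
      Matrix.diagonal ![‖z‖ * ‖z‖, 0] := by
    have : ‖z‖ * ‖z‖ = z.re * z.re + z.im * z.im := by
      rw [← Complex.normSq_apply, Complex.normSq_eq_norm_sq, sq]
    ext i j
    fin_cases i <;> fin_cases j <;> simp [columnMatrix, Matrix.mul_apply, this]
  have h2 := Matrix.l2_opNorm_conjTranspose_mul_self (columnMatrix z)
  rw [h1, Matrix.l2_opNorm_diagonal] at h2
  have h3 : ‖(![‖z‖ * ‖z‖, 0] : Fin 2 → ℝ)‖ = ‖z‖ * ‖z‖ := by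
    apply le_antisymm
    · rw [pi_norm_le_iff_of_nonneg (by positivity)]
      intro i
      fin_cases i <;> simp [mul_self_nonneg]
    · simpa using norm_le_pi_norm (![‖z‖ * ‖z‖, 0] : Fin 2 → ℝ) 0
  rw [h3] at h2
  nlinarith [norm_nonneg z, norm_nonneg (columnMatrix z)]

/-- Each part alone is a similarity, of ratio `‖p‖` or `‖q‖`; the triangle inequality does the rest.
-/
theorem norm_ofParts_le (p q : ℂ) : ‖ofParts p q‖ ≤ ‖p‖ + ‖q‖ := by
  have key : ∀ (M : Matrix (Fin 2) (Fin 2) ℝ) (z : ℂ),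
      M.conjTranspose * M = Matrix.diagonal (fun _ => ‖z‖ * ‖z‖) → ‖M‖ = ‖z‖ := by
    intro M z h
    have h2 := Matrix.l2_opNorm_conjTranspose_mul_self M
    rw [h, Matrix.l2_opNorm_diagonal, pi_norm_const, norm_mul, norm_norm] at h2
    nlinarith [norm_nonneg z, norm_nonneg M]
  have hn : ∀ z : ℂ, ‖z‖ * ‖z‖ = z.re * z.re + z.im * z.im := fun z => by
    rw [← Complex.normSq_apply, Complex.normSq_eq_norm_sq, sq]
  have h1 : ‖ofParts p 0‖ = ‖p‖ := by
    apply key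
    ext i j
    fin_cases i <;> fin_cases j <;> simp [ofParts, Matrix.mul_apply, hn] <;> ring
  have h2 : ‖ofParts 0 q‖ = ‖q‖ := by
    apply key
    ext i j
    fin_cases i <;> fin_cases j <;> simp [ofParts, Matrix.mul_apply, hn] <;> ring
  have h3 : ofParts p q = ofParts p 0 + ofParts 0 q := by
    ext i j
    fin_cases i <;> fin_cases j <;> simp [ofParts] <;> ring
  rw [h3, ← h1, ← h2]
  exact norm_add_le _ _

theorem chiralDisk_eq (A : Matrix (Fin 2) (Fin 2) ℝ) :
    chiralDisk A = Metric.closedBall (linPart A) ‖conjPart A‖ := by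
  rw [chiralDisk, Complex.norm_def, Complex.normSq_apply]
  simp [linPart, conjPart, sq]

@[simp]
theorem complexAction_one (z : ℂ) : complexAction 1 z = z := by
  have h1 : linPart 1 = 1 := by apply Complex.ext <;> simp [linPart]
  have h2 : conjPart 1 = 0 := by apply Complex.ext <;> simp [conjPart]
  simp [complexAction, h1, h2]

/-! ### The lower bound -/

/-- The ordered exponential moves every vector by a complex factor whose logarithm is bounded by
the cumulative norm. -/
theorem OrderedMeasure.norm_log_complexAction_div_le
    (φ : OrderedMeasure (Matrix (Fin 2) (Fin 2) ℝ)) (hφ : φ.var.real univ < Real.pi) {z : ℂ}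
    (hz : z ≠ 0) :
    ‖Complex.log (complexAction φ.Lexp z / z)‖ ≤ φ.var.real univ := by
  set T := φ.var.real univ with hT
  have hT0 : 0 ≤ T := measureReal_nonneg
  -- The logarithm `w` is a sum of principal logarithms of successive ratios. Whether `w` is itself
  -- principal is settled only in the limit, where its norm falls below `π`.
  have hchain : ∀ N : ℕ, 2 * T < N → ∃ w : ℂ, complexAction φ.Lexp z / z = Complex.exp w ∧
      ‖w‖ ≤ T / (1 - 2 * T / N) := by
    intro N hN
    have hN0 : (0 : ℝ) < N := lt_of_le_of_lt (by positivity) hN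
    obtain ⟨S, hS0, hSN, hlow, hsub, hmass⟩ :=
      exists_lowerSet_chain φ.var (N := N) (by exact_mod_cast hN0)
    rw [← hT] at hmass
    set ε := T / N with hε
    have hε0 : 0 ≤ ε := by positivity
    have hε1 : 2 * ε < 1 := by
      rw [hε, mul_div_assoc', div_lt_one hN0]
      exact hN
    have hstep : ∀ k ≤ N, ∃ w : ℂ, complexAction (φ.evolution (S k)) z = Complex.exp w * z ∧
        ‖w‖ ≤ k * (ε / (1 - 2 * ε)) := by
      intro k
      induction k with
      | zero =>
        intro _
        exact ⟨0, by simp [hS0], by simp⟩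
      | succ k ih =>
        intro hk
        obtain ⟨w, hw, hwn⟩ := ih (by omega)
        set a := complexAction (φ.evolution (S k)) z with ha
        set b := complexAction (φ.evolution (S (k + 1))) z with hb
        have ha0 : a ≠ 0 := by
          rw [hw]
          exact mul_ne_zero (Complex.exp_ne_zero _) hz
        have hinc := φ.norm_evolution_mul_sub_le (hlow (k + 1)) (hlow k) (hsub k)
          (hmass k (by omega)) (by linarith) (columnMatrix z)
        rw [mul_columnMatrix, mul_columnMatrix, columnMatrix_sub, norm_columnMatrix,
          norm_columnMatrix, ← ha, ← hb] at hinc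
        have hd : ‖(b - a) / a‖ ≤ ε / (1 - ε) := by
          rw [norm_div, div_le_iff₀ (norm_pos_iff.2 ha0)]
          exact hinc
        have hd1 : ε / (1 - ε) < 1 := by
          rw [div_lt_one (by linarith)]
          linarith
        have hq : 1 + (b - a) / a = b / a := by
          field_simp
          ring
        have hlog := Complex.norm_log_one_add_le (hd.trans_lt hd1)
        have hba : b / a ≠ 0 := by
          intro h0
          rw [← hq] at h0
          have h1 : (b - a) / a = -1 := by linear_combination h0
          rw [h1] at hd
          simp only [norm_neg, norm_one] at hd
          linarith
        refine ⟨Complex.log (b / a) + w, ?_, ?_⟩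
        · rw [Complex.exp_add, Complex.exp_log hba, mul_assoc, ← hw]
          field_simp
        -- Here `|log (1 + x)| ≤ d / (1 - d)` with `d = |x|`, evaluated at the largest value `d = ε
        -- / (1 - ε)`.
        · have hx : ‖Complex.log (b / a)‖ ≤ ε / (1 - 2 * ε) := by
            rw [← hq]
            refine hlog.trans ?_
            set d := ‖(b - a) / a‖
            have hd0 : 0 ≤ d := norm_nonneg _
            have hpos : 0 < 1 - d := by linarith
            calc d ^ 2 * (1 - d)⁻¹ / 2 + d ≤ d ^ 2 * (1 - d)⁻¹ + d := by
                  have : 0 ≤ d ^ 2 * (1 - d)⁻¹ := by positivity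
                  linarith
              _ = d / (1 - d) := by
                  field_simp
                  ring
              _ ≤ ε / (1 - 2 * ε) := by
                  rw [le_div_iff₀ (by linarith)] at hd
                  rw [div_le_div_iff₀ hpos (by linarith)]
                  nlinarith
          calc ‖Complex.log (b / a) + w‖ ≤ ε / (1 - 2 * ε) + k * (ε / (1 - 2 * ε)) :=
                (norm_add_le _ _).trans (add_le_add hx hwn)
            _ = (k + 1 : ℕ) * (ε / (1 - 2 * ε)) := by
                push_cast
                ring
    obtain ⟨w, hw, hwn⟩ := hstep N le_rfl
    rw [hSN, evolution_univ] at hw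
    refine ⟨w, by rw [hw]; field_simp, hwn.trans (le_of_eq ?_)⟩
    rw [hε, mul_div_assoc', mul_div_assoc', mul_div_assoc', mul_div_cancel_left₀ _ hN0.ne']
  have hlim : Tendsto (fun N : ℕ => T / (1 - 2 * T / N)) atTop (𝓝 T) := by
    have h1 := (tendsto_const_div_atTop_nhds_zero_nat (2 * T)).const_sub 1
    rw [sub_zero] at h1
    have h2 := (tendsto_const_nhds (x := T)).div h1 one_ne_zero
    rw [div_one] at h2
    exact h2
  refine ge_of_tendsto hlim ?_
  obtain ⟨N₀, hN₀⟩ := exists_nat_gt (2 * T)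
  filter_upwards [hlim.eventually (gt_mem_nhds hφ), eventually_ge_atTop N₀] with N hN hN'
  obtain ⟨w, hw, hwn⟩ := hchain N (hN₀.trans_le (by exact_mod_cast hN'))
  have him := abs_lt.1 ((Complex.abs_im_le_norm w).trans_lt (hwn.trans_lt hN))
  rw [hw, Complex.log_exp him.1 him.2.le]
  exact hwn

/-! ### Disks tangent to level curves of `|log|` -/

theorem mul_conj_eq_one_of_norm_eq_one {u : ℂ} (hu : ‖u‖ = 1) : u * (starRingEnd ℂ) u = 1 := by
  rw [Complex.mul_conj, Complex.normSq_eq_norm_sq, hu]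
  simp

/-- If `|log|` is maximal at the point `exp (l * u)` of a disk, then the disk is tangent there to
the level curve of `|log|`. -/
theorem center_of_isMax_norm_log {c u : ℂ} {R l : ℝ} (hR : 0 ≤ R) (hl : 0 < l) (hlpi : l < Real.pi)
    (hu : ‖u‖ = 1) (hle : ∀ z ∈ Metric.closedBall c R, ‖Complex.log z‖ ≤ l)
    (hmem : Complex.exp (l * u) ∈ Metric.closedBall c R) :
    c = Complex.exp (l * u) * (1 - (R / ‖Complex.exp (l * u)‖ : ℝ) * u) := by
  have hconj := mul_conj_eq_one_of_norm_eq_one hu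
  have hnlu : ‖(l : ℂ) * u‖ = l := by simp [hu, abs_of_pos hl]
  have him := abs_lt.1 ((Complex.abs_im_le_norm ((l : ℂ) * u)).trans_lt (hnlu.trans_lt hlpi))
  set z₀ := Complex.exp (l * u) with hz₀
  have hz₀0 : z₀ ≠ 0 := Complex.exp_ne_zero _
  have hlog : Complex.log z₀ = l * u := Complex.log_exp him.1 him.2.le
  have hslit : z₀ ∈ Complex.slitPlane := by
    rw [Complex.mem_slitPlane_iff_arg]
    refine ⟨?_, hz₀0⟩
    rw [← Complex.log_im, hlog]
    exact him.2.ne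
  have hmax : IsLocalMaxOn (fun z => ‖Complex.log z‖ ^ 2) (Metric.closedBall c R) z₀ := by
    refine IsMaxOn.localize fun z hz => ?_
    simp only [mem_ofPred_eq]
    rw [hlog, hnlu]
    gcongr
    exact hle z hz
  have hderiv := ((Complex.hasStrictDerivAt_log hslit).hasDerivAt.hasFDerivAt.restrictScalars
    ℝ).norm_sq
  -- First-order condition at the maximum: the derivative of `|log|²` at `z₀` in direction `v` is `2
  -- l Re (ū v / z₀)`, and by convexity every `z - z₀` is admissible.
  have hnonpos : ∀ z ∈ Metric.closedBall c R,
      (((starRingEnd ℂ) u * z₀⁻¹) * (z - z₀)).re ≤ 0 := by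
    intro z hz
    have h := hmax.hasFDerivWithinAt_nonpos hderiv.hasFDerivWithinAt
      (y := z - z₀) (mem_posTangentConeAt_of_segment_subset (by
        rw [add_sub_cancel]
        exact (convex_closedBall c R).segment_subset hmem hz))
    have h' : 2 * l * (((starRingEnd ℂ) u * z₀⁻¹) * (z - z₀)).re ≤ 0 := by
      convert h using 1
      simp [hlog, Complex.inner]
      ring
    exact nonpos_of_mul_nonpos_right h' (by positivity)
  set ζ := (starRingEnd ℂ) u * z₀⁻¹ with hζ
  have hζn : ‖ζ‖ = ‖z₀‖⁻¹ := by simp [hζ, hu]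
  have hζ0 : ζ ≠ 0 := by
    rw [← norm_ne_zero_iff, hζn]
    simpa using hz₀0
  have hzpos : 0 < ‖z₀‖ := norm_pos_iff.2 hz₀0
  -- This is the point of the disk farthest in the gradient direction. It forces `Re (ζ (z₀ - c)) ≥
  -- R / ‖z₀‖`, the equality case of the norm bound, so `ζ (z₀ - c)` is real and determines `c`.
  have h1 := hnonpos (c + (R * ‖z₀‖ : ℝ) * (starRingEnd ℂ) ζ) (by
    rw [mem_closedBall_iff_norm, add_sub_cancel_left, norm_mul, Complex.norm_conj, hζn,
      Complex.norm_real, Real.norm_of_nonneg (by positivity), mul_assoc,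
      mul_inv_cancel₀ hzpos.ne', mul_one])
  have hζζ : ζ * (starRingEnd ℂ) ζ = ((‖z₀‖⁻¹ ^ 2 : ℝ) : ℂ) := by
    rw [Complex.mul_conj, Complex.normSq_eq_norm_sq, hζn]
  have h2 : ζ * (c + (R * ‖z₀‖ : ℝ) * (starRingEnd ℂ) ζ - z₀) =
      -(ζ * (z₀ - c)) + ((R / ‖z₀‖ : ℝ) : ℂ) := by
    have : ((R / ‖z₀‖ : ℝ) : ℂ) = (R * ‖z₀‖ : ℝ) * (ζ * (starRingEnd ℂ) ζ) := by
      rw [hζζ, ← Complex.ofReal_mul]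
      congr 1
      field_simp
    rw [this]
    ring
  rw [h2, Complex.add_re, Complex.neg_re, Complex.ofReal_re] at h1
  have h3 : ‖ζ * (z₀ - c)‖ ≤ R / ‖z₀‖ := by
    rw [norm_mul, hζn, ← div_eq_inv_mul]
    gcongr
    rwa [← mem_closedBall_iff_norm]
  have h4 : ζ * (z₀ - c) = ((R / ‖z₀‖ : ℝ) : ℂ) := by
    have hre : (ζ * (z₀ - c)).re = ‖ζ * (z₀ - c)‖ :=
      le_antisymm (Complex.re_le_norm _) (by linarith)
    have h5 : (ζ * (z₀ - c)).re = R / ‖z₀‖ := le_antisymm (hre.trans_le h3) (by linarith)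
    have h6 := Complex.sq_norm_sub_sq_re (ζ * (z₀ - c))
    rw [← hre, sub_self] at h6
    apply Complex.ext
    · simpa using h5
    · simpa using pow_eq_zero_iff (two_ne_zero) |>.1 h6.symm
  have h7 : z₀ - c = ((R / ‖z₀‖ : ℝ) : ℂ) * u * z₀ := by
    rw [← h4, hζ]
    field_simp
    linear_combination (-(z₀ - c)) * hconj
  linear_combination -h7

/-- From an interior point `exp w` one could move to `exp (t w)` with `t > 1` close to `1`, staying
in the disk while `|log|` exceeds `l`. -/
theorem not_mem_ball_of_norm_log_le {c w : ℂ} {R l : ℝ} (hl : 0 < l) (hlpi : l < Real.pi)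
    (hle : ∀ z ∈ Metric.closedBall c R, ‖Complex.log z‖ ≤ l) (hw : ‖w‖ = l) :
    Complex.exp w ∉ Metric.ball c R := by
  intro h
  have hcont : Continuous fun t : ℝ => Complex.exp (t * w) := by fun_prop
  have h1 : ∀ᶠ t : ℝ in 𝓝 1, Complex.exp (t * w) ∈ Metric.ball c R :=
    hcont.continuousAt.eventually (Metric.isOpen_ball.mem_nhds (by simpa using h))
  have h2 : ∀ᶠ t : ℝ in 𝓝 1, t * l < Real.pi :=
    (continuous_mul_const l).continuousAt.eventually (gt_mem_nhds (by simpa using hlpi))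
  obtain ⟨t, ⟨ht1, ht2⟩, ht⟩ := (((h1.and h2).filter_mono nhdsWithin_le_nhds).and
    (self_mem_nhdsWithin (a := (1 : ℝ)) (s := Ioi 1))).exists
  have ht' : (1 : ℝ) < t := ht
  have hn : ‖(t : ℂ) * w‖ = t * l := by
    rw [norm_mul, hw, Complex.norm_real, Real.norm_of_nonneg (by linarith)]
  have him := abs_lt.1 ((Complex.abs_im_le_norm ((t : ℂ) * w)).trans_lt (hn.trans_lt ht2))
  have h3 := hle _ (Metric.ball_subset_closedBall ht1)
  rw [Complex.log_exp him.1 him.2.le, hn] at h3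
  nlinarith

/-- A disk tangent at `exp (l * u)` to the level curve of `|log|` and contained in the sublevel set
passes no further than the mirror image of the tangency point. -/
theorem radius_le_of_re_ne_zero {u : ℂ} {r l : ℝ} (hr : 0 ≤ r) (hl : 0 < l) (hlpi : l < Real.pi)
    (hu : ‖u‖ = 1) (hre : u.re ≠ 0)
    (hle : ∀ z ∈ Metric.closedBall (Complex.exp (l * u) * (1 - r * u))
      (r * ‖Complex.exp (l * u)‖), ‖Complex.log z‖ ≤ l) :
    r ≤ (1 - Real.exp (-2 * u.re * l)) / (2 * u.re) := by
  by_contra! hlt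
  -- At `r = m` the circle passes through `exp (-l ū)`, the inverse of `exp (l u)` in the unit
  -- circle, where `|log|` is again `l`. For `r > m` that point is interior.
  set m := (1 - Real.exp (-2 * u.re * l)) / (2 * u.re) with hm
  have hm1 : 1 - 2 * u.re * m = Real.exp (-2 * u.re * l) := by
    rw [hm]
    field_simp
    ring
  have hm0 : 0 < m := by
    rw [hm]
    rcases lt_or_gt_of_ne hre with h | h
    · refine div_pos_of_neg_of_neg ?_ (by linarith)
      rw [sub_neg, Real.one_lt_exp_iff]
      nlinarith
    · refine div_pos ?_ (by linarith)
      rw [sub_pos, Real.exp_lt_one_iff]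
      nlinarith
  have hw : ‖-(l : ℂ) * (starRingEnd ℂ) u‖ = l := by simp [hu, abs_of_pos hl]
  refine not_mem_ball_of_norm_log_le hl hlpi hle hw ?_
  have he : Complex.exp (-(l : ℂ) * (starRingEnd ℂ) u) =
      Complex.exp (l * u) * ((1 - 2 * u.re * m : ℝ) : ℂ) := by
    rw [hm1, Complex.ofReal_exp, ← Complex.exp_add]
    congr 1
    apply Complex.ext <;> simp
    ring
  have hE : 0 < ‖Complex.exp (l * u)‖ := norm_pos_iff.2 (Complex.exp_ne_zero _)
  have hu2 : u.re ^ 2 + u.im ^ 2 = 1 := by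
    have := Complex.sq_norm_sub_sq_re u
    rw [hu] at this
    linarith
  rw [mem_ball_iff_norm, he, ← mul_sub, norm_mul, mul_comm]
  refine mul_lt_mul_of_pos_right ?_ hE
  refine lt_of_pow_lt_pow_left₀ 2 hr ?_
  rw [← Complex.normSq_eq_norm_sq, Complex.normSq_apply]
  simp only [Complex.sub_re, Complex.sub_im, Complex.ofReal_re, Complex.ofReal_im, Complex.one_re,
    Complex.one_im, Complex.mul_re, Complex.mul_im, zero_mul, sub_zero, add_zero]
  have hpos : 0 < u.re ^ 2 * m * (r - m) := by
    have := sub_pos.2 hlt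
    positivity
  nlinarith

/-- To first order in `k` the expression is `l k (l - r)`. The condition `h1` in the proof is the
explicit remainder estimate divided by `l k`. -/
theorem exists_small_pos_of_lt {l r : ℝ} (hl : 0 < l) (hlr : l < r) :
    ∃ k : ℝ, 0 < k ∧ k ≤ 1 ∧ Real.cosh (l * √(k * (2 - k))) - Real.cos (l * k)
      - r * Real.sin (l * k) < 0 := by
  have h1 : ∀ᶠ k : ℝ in 𝓝 0, l + l ^ 3 * k + l * k / 2 + r * l ^ 2 * k ^ 2 / 4 < r := by
    have : Continuous fun k : ℝ => l + l ^ 3 * k + l * k / 2 + r * l ^ 2 * k ^ 2 / 4 := by fun_prop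
    exact this.continuousAt.eventually (gt_mem_nhds (by simpa using hlr))
  have h2 : ∀ᶠ k : ℝ in 𝓝 0, l * k < 1 :=
    (continuous_const_mul l).continuousAt.eventually (gt_mem_nhds (by simp))
  have h3 : ∀ᶠ k : ℝ in 𝓝 0, l ^ 2 * k < 1 :=
    (continuous_const_mul (l ^ 2)).continuousAt.eventually (gt_mem_nhds (by simp))
  have h4 : ∀ᶠ k : ℝ in 𝓝 0, k < 1 := gt_mem_nhds zero_lt_one
  obtain ⟨k, ⟨⟨⟨⟨hk1, hk2⟩, hk3⟩, hk4⟩, hk0⟩⟩ :=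
    ((((h1.and h2).and h3).and h4).filter_mono nhdsWithin_le_nhds |>.and
    (self_mem_nhdsWithin (a := (0 : ℝ)) (s := Ioi 0))).exists
  have hk0 : 0 < k := hk0
  refine ⟨k, hk0, hk4.le, ?_⟩
  have hlk : 0 < l * k := by positivity
  have c1 : Real.cosh (l * √(k * (2 - k))) ≤ 1 + l ^ 2 * k + (l ^ 2 * k) ^ 2 := by
    refine (Real.cosh_le_exp_half_sq _).trans ?_
    have e : (l * √(k * (2 - k))) ^ 2 / 2 ≤ l ^ 2 * k := by
      rw [mul_pow, Real.sq_sqrt (by nlinarith)]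
      nlinarith [mul_pos (pow_pos hl 2) (pow_pos hk0 2)]
    refine (Real.exp_le_exp.2 e).trans ?_
    have hpos : 0 ≤ l ^ 2 * k := by positivity
    have := (abs_le.1 (Real.abs_exp_sub_one_sub_id_le
      (x := l ^ 2 * k) (by rw [abs_of_nonneg hpos]; exact hk3.le))).2
    linarith
  have c2 := Real.one_sub_sq_div_two_le_cos (x := l * k)
  have c3 : l * k - (l * k) ^ 3 / 4 < Real.sin (l * k) := by
    have := Real.sin_gt_sub_cube hlk
    have := pow_pos hlk 3
    linarith
  have c4 : r * (l * k - (l * k) ^ 3 / 4) ≤ r * Real.sin (l * k) :=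
    mul_le_mul_of_nonneg_left c3.le (hl.trans hlr).le
  have c5 := mul_lt_mul_of_pos_left hk1 hlk
  nlinarith

/-- The inverse point now coincides with the tangency point, so curvatures are compared instead: for
`r > l` nearby points of the level curve enter the open disk. -/
theorem radius_le_of_re_eq_zero {u : ℂ} {r l : ℝ} (hr : 0 ≤ r) (hl : 0 < l) (hlpi : l < Real.pi)
    (hu : ‖u‖ = 1) (hre : u.re = 0)
    (hle : ∀ z ∈ Metric.closedBall (Complex.exp (l * u) * (1 - r * u))
      (r * ‖Complex.exp (l * u)‖), ‖Complex.log z‖ ≤ l) :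
    r ≤ l := by
  by_contra! hlt
  obtain ⟨k, hk0, hk1, hk⟩ := exists_small_pos_of_lt hl hlt
  have hu2 : u.im ^ 2 = 1 := by
    have := Complex.sq_norm_sub_sq_re u
    rw [hu, hre] at this
    linarith
  -- Chosen so that `s + (1 - k) u` is a unit vector, close to `u` for small `k`.
  set s := √(k * (2 - k)) with hs
  have hs2 : s ^ 2 = k * (2 - k) := Real.sq_sqrt (by nlinarith)
  have hw : ‖(l : ℂ) * (s + (1 - k : ℝ) * u)‖ = l := by
    have h1 : ‖(s : ℂ) + (1 - k : ℝ) * u‖ = 1 := by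
      rw [← sq_eq_sq₀ (norm_nonneg _) zero_le_one, ← Complex.normSq_eq_norm_sq,
        Complex.normSq_apply]
      simp [hre]
      nlinarith
    rw [norm_mul, h1, Complex.norm_real, Real.norm_of_nonneg hl.le, mul_one]
  refine not_mem_ball_of_norm_log_le hl hlpi hle hw ?_
  have he : Complex.exp ((l : ℂ) * (s + (1 - k : ℝ) * u)) =
      Complex.exp (l * u) * Complex.exp ((l * s : ℝ) + -(l * k : ℝ) * u) := by
    rw [← Complex.exp_add]
    congr 1
    push_cast
    ring
  have hE : 0 < ‖Complex.exp (l * u)‖ := norm_pos_iff.2 (Complex.exp_ne_zero _)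
  rw [mem_ball_iff_norm, he, ← mul_sub, norm_mul, mul_comm]
  refine mul_lt_mul_of_pos_right ?_ hE
  refine lt_of_pow_lt_pow_left₀ 2 hr ?_
  have hpos := Real.exp_pos (l * s)
  have hcosh : Real.exp (l * s) * (2 * Real.cosh (l * s)) = Real.exp (l * s) ^ 2 + 1 := by
    rw [Real.cosh_eq, Real.exp_neg]
    field_simp
  have hsq := Real.sin_sq_add_cos_sq (l * k)
  have hcos : Real.cos (-(l * k) * u.im) = Real.cos (l * k) := by
    rcases eq_or_eq_neg_of_sq_eq_sq u.im 1 (by rw [hu2]; norm_num) with h | h <;> simp [h]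
  have hsin : Real.sin (-(l * k) * u.im) = -u.im * Real.sin (l * k) := by
    rcases eq_or_eq_neg_of_sq_eq_sq u.im 1 (by rw [hu2]; norm_num) with h | h <;> simp [h]
  rw [← Complex.normSq_eq_norm_sq, Complex.normSq_apply]
  simp only [Complex.sub_re, Complex.sub_im, Complex.exp_re, Complex.exp_im]
  have e1 : (((l * s : ℝ) : ℂ) + -(l * k : ℝ) * u).re = l * s := by simp [hre]
  have e2 : (((l * s : ℝ) : ℂ) + -(l * k : ℝ) * u).im = -(l * k) * u.im := by simp
  rw [e1, e2, hcos, hsin]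
  simp [hre]
  have h := mul_neg_of_pos_of_neg hpos hk
  set e := Real.exp (l * s)
  calc _ = r ^ 2 + 2 * (e * (Real.cosh (l * s) - Real.cos (l * k) - r * Real.sin (l * k))) := by
        linear_combination ((e * Real.sin (l * k) - r) ^ 2) * hu2 + e ^ 2 * hsq - hcosh
    _ < r ^ 2 := by linarith

/-! ### Constructing an optimal measure -/

/-- With `σ = 1` the profile ends at the largest admissible radius, with `σ = 0` it stays at zero;
the intermediate value theorem selects `σ`. -/
theorem exists_radius_profile {p r l : ℝ} (hl : 0 < l) (hr : 0 ≤ r)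
    (hp : p ≠ 0 → r ≤ (1 - Real.exp (-2 * p * l)) / (2 * p)) (hp0 : p = 0 → r ≤ l) :
    ∃ σ ∈ Icc (0 : ℝ) 1, ∃ ρ : ℝ → ℝ, ρ 0 = 0 ∧ ρ l = r ∧
      ∀ t, HasDerivAt ρ (σ * (1 - 2 * p * ρ t)) t := by
  by_cases h : p = 0
  · refine ⟨r / l, ⟨by positivity, (div_le_one hl).2 (hp0 h)⟩, fun t => r / l * t, by simp,
      by field_simp, fun t => ?_⟩
    simpa [h] using (hasDerivAt_id t).const_mul (r / l)
  · have hcont : ContinuousOn (fun σ : ℝ => (1 - Real.exp (-2 * p * σ * l)) / (2 * p))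
        (Icc 0 1) := by fun_prop
    have hmem : r ∈ Icc ((1 - Real.exp (-2 * p * 0 * l)) / (2 * p))
        ((1 - Real.exp (-2 * p * 1 * l)) / (2 * p)) :=
      ⟨by simpa using hr, by simpa using hp h⟩
    obtain ⟨σ, hσ, hσr⟩ := intermediate_value_Icc zero_le_one hcont hmem
    refine ⟨σ, hσ, fun t => (1 - Real.exp (-2 * p * σ * t)) / (2 * p), by simp, hσr, fun t => ?_⟩
    have h1 := ((((hasDerivAt_id t).const_mul (-2 * p * σ)).exp.const_sub 1).div_const (2 * p))
    refine h1.congr_deriv ?_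
    simp only [id]
    field_simp
    ring

/-- The real linear map sending a pair of parts to the matrix with these parts. -/
noncomputable def ofPartsCLM : ℂ × ℂ →L[ℝ] Matrix (Fin 2) (Fin 2) ℝ :=
  LinearMap.toContinuousLinearMap
    { toFun := fun x => ofParts x.1 x.2
      map_add' := fun x y => by
        ext i j
        fin_cases i <;> fin_cases j <;> simp [ofParts] <;> ring
      map_smul' := fun c x => by
        ext i j
        fin_cases i <;> fin_cases j <;> simp [ofParts] <;> ring }

theorem ofPartsCLM_apply (p q : ℂ) : ofPartsCLM (p, q) = ofParts p q := rfl

/-- Every matrix whose chiral disk is tangent at `exp (l * u)`, with a radius reachable by a radius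
profile, is the ordered exponential of a measure of cumulative norm at most `l`. -/
theorem exists_orderedMeasure_of_profile {u κ : ℂ} {l σ : ℝ} {ρ : ℝ → ℝ} (hu : ‖u‖ = 1)
    (hκ : ‖κ‖ = 1) (hl : 0 ≤ l) (hσ : σ ∈ Icc (0 : ℝ) 1) (hρ0 : ρ 0 = 0)
    (hρ : ∀ t, HasDerivAt ρ (σ * (1 - 2 * u.re * ρ t)) t) :
    ∃ φ : OrderedMeasure (Matrix (Fin 2) (Fin 2) ℝ),
      φ.Lexp = ofParts (Complex.exp (l * u) * (1 - ρ l * u)) (κ * (u * Complex.exp (l * u) * ρ l)) ∧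
      φ.cumulativeNorm ≤ ENNReal.ofReal l := by
  set e : ℝ → ℂ := fun t => Complex.exp (t * u) with he
  -- The phase `e / ē`, needed because the conjugate linear part of the generator acts on conjugated
  -- quantities.
  set g : ℝ → ℂ := fun t => Complex.exp ((2 * t * u.im : ℝ) * Complex.I) with hg
  have heg : ∀ t, g t * (starRingEnd ℂ) (e t) = e t := by
    intro t
    simp only [he, hg]
    rw [← Complex.exp_conj, ← Complex.exp_add]
    congr 1
    apply Complex.ext <;> simp
    ring
  have hκκ := mul_conj_eq_one_of_norm_eq_one hκ
  have hre : (2 * u.re : ℂ) = u + (starRingEnd ℂ) u := by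
    rw [Complex.add_conj]
    push_cast
    ring
  -- The unit norm budget is split between the linear part, `1 - σ`, and the conjugate linear part,
  -- `σ`.
  refine exists_orderedMeasure_of_hasDerivAt hl
    (h := fun t => ofParts ((1 - σ : ℝ) * u) (σ * (u * (κ * g t))))
    (X := fun t => ofParts (e t * (1 - ρ t * u)) (κ * (u * e t * ρ t))) ?_ ?_ ?_ ?_
  · have : Continuous fun t : ℝ => (((1 - σ : ℝ) * u, σ * (u * (κ * g t))) : ℂ × ℂ) := by
      fun_prop
    exact ofPartsCLM.continuous.comp this
  · intro t
    refine (norm_ofParts_le _ _).trans (le_of_eq ?_)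
    have h1 : ‖g t‖ = 1 := Complex.norm_exp_ofReal_mul_I _
    rw [norm_mul, norm_mul, norm_mul, norm_mul, hu, hκ, h1, Complex.norm_real, Complex.norm_real,
      Real.norm_of_nonneg hσ.1, Real.norm_of_nonneg (by linarith [hσ.2])]
    ring
  · intro t
    have de : HasDerivAt e (e t * u) t := by
      have h1 : HasDerivAt (fun t : ℝ => (t : ℂ) * u) (1 * u) t :=
        (hasDerivAt_id t).ofReal_comp.mul_const u
      simpa using h1.cexp
    have dρ := (hρ t).ofReal_comp
    have dα := de.mul ((dρ.mul_const u).const_sub 1)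
    have dβ := ((de.const_mul u).mul dρ).const_mul κ
    refine (ofPartsCLM.hasFDerivAt.comp_hasDerivAt t (dα.prodMk dβ)).congr_deriv ?_
    rw [ofPartsCLM_apply, ofParts_mul]
    congr 1
    · simp only [map_mul, Complex.conj_ofReal]
      push_cast
      rw [hre]
      linear_combination (-(σ * u * (starRingEnd ℂ) u * ρ t * g t * (starRingEnd ℂ) (e t))) * hκκ -
        (σ * u * (starRingEnd ℂ) u * ρ t) * heg t
    · simp only [map_mul, map_sub, map_one, Complex.conj_ofReal]
      push_cast
      rw [hre]
      linear_combination (-(σ * u * κ * (1 - ρ t * (starRingEnd ℂ) u))) * heg t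
  · simp [he, hρ0, ofParts_one_zero]

theorem exists_unit_mul_eq {a b : ℂ} (h : ‖a‖ = ‖b‖) : ∃ κ : ℂ, ‖κ‖ = 1 ∧ a = κ * b := by
  by_cases hb : b = 0
  · exact ⟨1, by simp, by simpa [hb] using h⟩
  · refine ⟨a / b, ?_, by field_simp⟩
    rw [norm_div, h, div_self (norm_ne_zero_iff.2 hb)]

/-! ### The main theorem -/

/-- Every boundary point of the chiral disk is a ratio `A x / x`. -/
theorem exists_complexAction_div_eq {A : Matrix (Fin 2) (Fin 2) ℝ} {z : ℂ}
    (hz : ‖conjPart A‖ = ‖z - linPart A‖) : ∃ x : ℂ, x ≠ 0 ∧ complexAction A x / x = z := by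
  obtain ⟨κ, hκ, hAκ⟩ := exists_unit_mul_eq hz
  -- For `|x| = 1` one has `x̄ / x = x⁻²`, so a square root of the phase `κ` cancels it.
  obtain ⟨x, hx⟩ := IsAlgClosed.exists_pow_nat_eq κ two_pos
  have hx1 : ‖x‖ = 1 := by
    rw [← hx, norm_pow] at hκ
    exact (pow_eq_one_iff_of_nonneg (norm_nonneg _) two_ne_zero).1 hκ
  have hx0 : x ≠ 0 := by
    rw [← norm_ne_zero_iff, hx1]
    exact one_ne_zero
  have hxx := mul_conj_eq_one_of_norm_eq_one hx1
  refine ⟨x, hx0, ?_⟩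
  rw [div_eq_iff hx0, complexAction, hAκ, ← hx]
  linear_combination (z - linPart A) * x * hxx

/-- Real `2 × 2` matrices carry the operator norm of the Euclidean norm on `ℝ²`
(`Matrix.Norms.L2Operator`). -/
theorem mainTheorem1 (A : Matrix (Fin 2) (Fin 2) ℝ)
    (hA : chiralDisk A ⊆ Complex.exp '' Metric.ball (0 : ℂ) Real.pi) :
    ∃ m : ℝ, magnusExponent A = ENNReal.ofReal m ∧
      IsLeast {l : ℝ | l ∈ Set.Ico 0 Real.pi ∧
        chiralDisk A ⊆ Complex.exp '' Metric.closedBall (0 : ℂ) l} m ∧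
      IsLUB ((fun z : ℂ => ‖Complex.log z‖) '' chiralDisk A) m := by
  have hlogexp : ∀ w : ℂ, ‖w‖ < Real.pi → Complex.log (Complex.exp w) = w := fun w hw => by
    have him := abs_lt.1 ((Complex.abs_im_le_norm w).trans_lt hw)
    exact Complex.log_exp him.1 him.2.le
  have hpt : ∀ z ∈ chiralDisk A, z ∈ Complex.slitPlane ∧ ‖Complex.log z‖ < Real.pi := by
    intro z hz
    obtain ⟨w, hw, rfl⟩ := hA hz
    rw [mem_ball_zero_iff] at hw
    rw [hlogexp w hw, Complex.mem_slitPlane_iff_arg, ← Complex.log_im, hlogexp w hw]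
    exact ⟨⟨(abs_lt.1 ((Complex.abs_im_le_norm w).trans_lt hw)).2.ne, Complex.exp_ne_zero _⟩, hw⟩
  have hdisk := chiralDisk_eq A
  set c := linPart A with hc
  set R := ‖conjPart A‖ with hR
  have hR0 : 0 ≤ R := norm_nonneg _
  obtain ⟨z₀, hz₀, hmax⟩ : ∃ z₀ ∈ chiralDisk A, ∀ z ∈ chiralDisk A,
      ‖Complex.log z‖ ≤ ‖Complex.log z₀‖ := by
    have hcont : ContinuousOn (fun z => ‖Complex.log z‖) (chiralDisk A) :=
      fun z hz => (continuousAt_clog (hpt z hz).1).norm.continuousWithinAt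
    rw [hdisk] at hcont ⊢
    exact (isCompact_closedBall c R).exists_isMaxOn ⟨c, Metric.mem_closedBall_self hR0⟩ hcont
  have hpi := (hpt z₀ hz₀).2
  have hexp : Complex.exp (Complex.log z₀) = z₀ :=
    Complex.exp_log (Complex.slitPlane_ne_zero (hpt z₀ hz₀).1)
  set m := ‖Complex.log z₀‖ with hm
  refine ⟨m, ?_, ⟨⟨⟨norm_nonneg _, hpi⟩, fun z hz => ?_⟩, ?_⟩, ?_⟩
  -- If the maximum is zero, there is no direction `u`; the disk is then `{1}`, so `A = 1`, realised
  -- by the zero density.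
  · rcases (norm_nonneg (Complex.log z₀)).eq_or_lt with h0 | hpos
    · rw [← hm] at h0
      have hone : ∀ z ∈ chiralDisk A, z = 1 := by
        intro z hz
        have h1 := hmax z hz
        rw [← h0, norm_le_zero_iff] at h1
        rw [← Complex.exp_log (Complex.slitPlane_ne_zero (hpt z hz).1), h1, Complex.exp_zero]
      rw [hdisk] at hone
      have h1 := hone c (Metric.mem_closedBall_self hR0)
      have h2 := hone (c + conjPart A) (by rw [mem_closedBall_iff_norm, add_sub_cancel_left])
      have h3 : conjPart A = 0 := by
        rw [h1] at h2
        simpa using h2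
      have hA1 : A = 1 := by
        rw [← ofParts_linPart_conjPart A, ← hc, h1, h3, ofParts_one_zero]
      obtain ⟨φ, hφ, hn⟩ := exists_orderedMeasure_of_hasDerivAt (le_refl (0 : ℝ))
        (h := fun _ => (0 : Matrix (Fin 2) (Fin 2) ℝ)) (X := fun _ => 1) continuous_const
        (by simp) (fun t => by simpa using hasDerivAt_const t (1 : Matrix (Fin 2) (Fin 2) ℝ)) rfl
      rw [← h0]
      refine le_antisymm ((iInf₂_le φ (hφ.trans hA1.symm)).trans hn) (by simp)
    rw [← hm] at hpos
    have hmc : (m : ℂ) ≠ 0 := by exact_mod_cast hpos.ne'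
    set u := Complex.log z₀ / m with hu
    have hu1 : ‖u‖ = 1 := by
      rw [hu, norm_div, Complex.norm_real, Real.norm_of_nonneg hpos.le, ← hm, div_self hpos.ne']
    have hz₀u : z₀ = Complex.exp (m * u) := by
      rw [hu, mul_div_cancel₀ _ hmc, hexp]
    have hmax' := hmax
    rw [hdisk] at hmax' hz₀
    rw [hz₀u] at hz₀
    have hcenter := center_of_isMax_norm_log hR0 hpos hpi hu1 hmax' hz₀
    have hE : 0 < ‖Complex.exp (m * u)‖ := norm_pos_iff.2 (Complex.exp_ne_zero _)
    set r := R / ‖Complex.exp (m * u)‖ with hr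
    have hr0 : 0 ≤ r := by positivity
    have hrR : r * ‖Complex.exp (m * u)‖ = R := by
      rw [hr]
      field_simp
    have hrad : ‖conjPart A‖ = ‖u * Complex.exp (m * u) * r‖ := by
      rw [norm_mul, norm_mul, hu1, one_mul, mul_comm, Complex.norm_real,
        Real.norm_of_nonneg hr0, hrR]
    refine le_antisymm ?_ ?_
    · rw [hcenter, ← hrR] at hmax'
      obtain ⟨σ, hσ, ρ, hρ0, hρm, hρ⟩ := exists_radius_profile hpos hr0
        (fun h => radius_le_of_re_ne_zero hr0 hpos hpi hu1 h hmax')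
        (fun h => radius_le_of_re_eq_zero hr0 hpos hpi hu1 h hmax')
      obtain ⟨κ, hκ, hκA⟩ := exists_unit_mul_eq hrad
      obtain ⟨φ, hφ, hn⟩ := exists_orderedMeasure_of_profile hu1 hκ hpos.le hσ hρ0 hρ
      rw [hρm, ← hcenter, ← hκA, hc, ofParts_linPart_conjPart] at hφ
      exact (iInf₂_le φ hφ).trans hn
    · refine le_iInf₂ fun φ hφ => ?_
      rw [φ.cumulativeNorm_eq]
      refine ENNReal.ofReal_le_ofReal ?_
      rcases le_or_gt Real.pi (φ.var.real univ) with h | h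
      · exact hpi.le.trans h
      obtain ⟨x, hx, hxz⟩ := exists_complexAction_div_eq (A := A) (z := z₀) (by
        rw [hrad, ← hc]
        congr 1
        rw [hz₀u]
        linear_combination hcenter)
      have := φ.norm_log_complexAction_div_le h hx
      rwa [hφ, hxz] at this
  · exact ⟨Complex.log z, by simpa using hmax z hz,
      Complex.exp_log (Complex.slitPlane_ne_zero (hpt z hz).1)⟩
  · rintro l ⟨hl, hsub⟩
    obtain ⟨w, hw, hwz⟩ := hsub hz₀
    rw [mem_closedBall_zero_iff] at hw
    rw [hm, ← hwz, hlogexp w (hw.trans_lt hl.2)]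
    exact hw
  · refine IsGreatest.isLUB ⟨⟨z₀, hz₀, rfl⟩, ?_⟩
    rintro _ ⟨z, hz, rfl⟩
    exact hmax z hz
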